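/- Algebras are complex and associative, not necessarily unital or commutative. A seminorm on an algebra is a submultiplicative (vector space) seminorm $p$, and it is uniform if $p(x^2)=p(x)^2$ for all $x$. Let $(E,(p_\alpha)_{\alpha\in\Lambda})$ be a uniform topological algebra, that is, an algebra $E$ which is a Hausdorff topological vector space with separately continuous multiplication, whose topology is determined by the directed family $(p_\alpha)_{\alpha\in\Lambda}$ of uniform seminorms. For $\alpha\in\Lambda$ let $\ker(p_\alpha)=\{x\in E:p_\alpha(x)=0\}$, let $E_\alpha=E/\ker(p_\alpha)$ be the quotient algebra and $f_\alpha:E\to E_\alpha$ the quotient map. Write $\alpha\le\beta$ if $p_\alpha(x)\le p_\beta(x)$ for all $x\in E$; in that case let $f_{\alpha\beta}:E_\beta\to E_\alpha$ be the homomorphism $x+\ker(p_\beta)\mapsto x+\ker(p_\alpha)$. For an algebra $A$ let $M(A)$ be the set of multipliers of $A$, i.e. of all maps $T:A\to A$ with $T(x)y=xT(y)$ for all $x,y\in A$. Then: (i) $T(\ker(f_\alpha))\subset\ker(f_\alpha)$ for all $T\in M(E)$ and $\alpha\in\Lambda$; (j) $U(\ker(f_{\alpha\beta}))\subset\ker(f_{\alpha\beta})$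 for all $\alpha\le\beta$ in $\Lambda$ and $U\in M(E_\beta)$. -/

import Mathlib

/-- A map `T : A → A` (not assumed additive, linear or continuous) is a multiplier if
`T x * y = x * T y` for all `x`, `y`. -/
def IsMultiplier {A : Type*} [Mul A] (T : A → A) : Prop :=
  ∀ x y : A, T x * y = x * T y

/-- The set `M(A)` of all multipliers of `A`. -/
def multipliers (A : Type*) [Mul A] : Set (A → A) :=
  {T | IsMultiplier T}

/-- A submultiplicative seminorm on a complex algebra. -/
structure AlgSeminorm (E : Type*) [NonUnitalRing E] [Module ℂ E] extends Seminorm ℂ E where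
  mul_le' : ∀ x y : E, toFun (x * y) ≤ toFun x * toFun y

namespace AlgSeminorm

section Basic

variable {E : Type*} [NonUnitalRing E] [Module ℂ E]

/-- A uniform seminorm: one with the square property `p (x²) = p (x)²`. -/
def IsUniform (p : AlgSeminorm E) : Prop :=
  ∀ x : E, p.toSeminorm (x * x) = p.toSeminorm x ^ 2

/-- The null space `{x | p x = 0}`. -/
def nullSpace (p : AlgSeminorm E) : Submodule ℂ E where
  carrier := {x | p.toSeminorm x = 0}
  zero_mem' := map_zero p.toSeminorm
  add_mem' := fun {x y} hx hy => le_antisymm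
    ((map_add_le_add p.toSeminorm x y).trans (by
      rw [Set.mem_ofPred_eq] at hx hy
      rw [hx, hy, add_zero]))
    (apply_nonneg p.toSeminorm _)
  smul_mem' := fun c x hx => by
    rw [Set.mem_ofPred_eq] at hx ⊢
    rw [map_smul_eq_mul, hx, mul_zero]

theorem mem_nullSpace {p : AlgSeminorm E} {x : E} : x ∈ p.nullSpace ↔ p.toSeminorm x = 0 :=
  Iff.rfl

theorem mul_mem_nullSpace_left (p : AlgSeminorm E) (x : E) {y : E} (hy : y ∈ p.nullSpace) :
    x * y ∈ p.nullSpace :=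
  le_antisymm ((p.mul_le' x y).trans (mul_nonpos_of_nonneg_of_nonpos
    (apply_nonneg p.toSeminorm x) (le_of_eq hy))) (apply_nonneg p.toSeminorm _)

theorem mul_mem_nullSpace_right (p : AlgSeminorm E) {x : E} (hx : x ∈ p.nullSpace) (y : E) :
    x * y ∈ p.nullSpace :=
  le_antisymm ((p.mul_le' x y).trans (mul_nonpos_of_nonpos_of_nonneg
    (le_of_eq hx) (apply_nonneg p.toSeminorm y))) (apply_nonneg p.toSeminorm _)

theorem nullSpace_mono {p q : AlgSeminorm E} (h : p.toSeminorm ≤ q.toSeminorm) :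
    q.nullSpace ≤ p.nullSpace :=
  fun x hx => le_antisymm ((h x).trans (le_of_eq hx)) (apply_nonneg p.toSeminorm x)

/-- The factor algebra `E / ker p`. -/
def Factor (p : AlgSeminorm E) : Type _ := E ⧸ p.nullSpace

noncomputable instance (p : AlgSeminorm E) : AddCommGroup p.Factor :=
  inferInstanceAs (AddCommGroup (E ⧸ p.nullSpace))

noncomputable instance (p : AlgSeminorm E) : Module ℂ p.Factor :=
  inferInstanceAs (Module ℂ (E ⧸ p.nullSpace))

/-- The class `x + ker p`. -/
def toFactor (p : AlgSeminorm E) (x : E) : p.Factor := Submodule.Quotient.mk x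

/-- Multiplication of classes: `(x + ker p) (y + ker p) = x * y + ker p`. -/
instance (p : AlgSeminorm E) : Mul p.Factor where
  mul := Quotient.map₂ (· * ·) (by
    intro a b hab c d hcd
    have h1 : a - b ∈ p.nullSpace := (Submodule.quotientRel_def p.nullSpace).1 hab
    have h2 : c - d ∈ p.nullSpace := (Submodule.quotientRel_def p.nullSpace).1 hcd
    refine (Submodule.quotientRel_def p.nullSpace).2 ?_
    have h3 : a * c - b * d = a * (c - d) + (a - b) * d := by
      rw [mul_sub, sub_mul]; abel
    rw [h3]
    exact p.nullSpace.add_mem (p.mul_mem_nullSpace_left a h2) (p.mul_mem_nullSpace_right h1 d))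

theorem toFactor_surjective (p : AlgSeminorm E) : Function.Surjective p.toFactor :=
  Submodule.Quotient.mk_surjective p.nullSpace

theorem toFactor_mul (p : AlgSeminorm E) (x y : E) :
    p.toFactor (x * y) = p.toFactor x * p.toFactor y := rfl

theorem toFactor_add (p : AlgSeminorm E) (x y : E) :
    p.toFactor (x + y) = p.toFactor x + p.toFactor y := rfl

theorem toFactor_smul (p : AlgSeminorm E) (c : ℂ) (x : E) :
    p.toFactor (c • x) = c • p.toFactor x := rfl

theorem toFactor_zero (p : AlgSeminorm E) : p.toFactor 0 = 0 := rfl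

theorem toFactor_eq_zero {p : AlgSeminorm E} {x : E} :
    p.toFactor x = 0 ↔ p.toSeminorm x = 0 :=
  Submodule.Quotient.mk_eq_zero p.nullSpace

noncomputable instance (p : AlgSeminorm E) : NonUnitalRing p.Factor where
  left_distrib a b c := by
    obtain ⟨x, rfl⟩ := p.toFactor_surjective a
    obtain ⟨y, rfl⟩ := p.toFactor_surjective b
    obtain ⟨z, rfl⟩ := p.toFactor_surjective c
    exact congrArg p.toFactor (mul_add x y z)
  right_distrib a b c := by
    obtain ⟨x, rfl⟩ := p.toFactor_surjective a
    obtain ⟨y, rfl⟩ := p.toFactor_surjective b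
    obtain ⟨z, rfl⟩ := p.toFactor_surjective c
    exact congrArg p.toFactor (add_mul x y z)
  zero_mul a := by
    obtain ⟨x, rfl⟩ := p.toFactor_surjective a
    exact congrArg p.toFactor (zero_mul x)
  mul_zero a := by
    obtain ⟨x, rfl⟩ := p.toFactor_surjective a
    exact congrArg p.toFactor (mul_zero x)
  mul_assoc a b c := by
    obtain ⟨x, rfl⟩ := p.toFactor_surjective a
    obtain ⟨y, rfl⟩ := p.toFactor_surjective b
    obtain ⟨z, rfl⟩ := p.toFactor_surjective c
    exact congrArg p.toFactor (mul_assoc x y z)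

instance [IsScalarTower ℂ E E] (p : AlgSeminorm E) :
    IsScalarTower ℂ p.Factor p.Factor where
  smul_assoc c a b := by
    obtain ⟨x, rfl⟩ := p.toFactor_surjective a
    obtain ⟨y, rfl⟩ := p.toFactor_surjective b
    exact congrArg p.toFactor (smul_mul_assoc c x y)

instance [SMulCommClass ℂ E E] (p : AlgSeminorm E) :
    SMulCommClass ℂ p.Factor p.Factor where
  smul_comm c a b := by
    obtain ⟨x, rfl⟩ := p.toFactor_surjective a
    obtain ⟨y, rfl⟩ := p.toFactor_surjective b
    exact congrArg p.toFactor (mul_smul_comm c x y).symm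

/-- The quotient homomorphism `E → E / ker p`, `x ↦ x + ker p`. -/
noncomputable def quotientHom (p : AlgSeminorm E) : E →ₙₐ[ℂ] p.Factor where
  toFun := p.toFactor
  map_smul' := p.toFactor_smul
  map_zero' := p.toFactor_zero
  map_add' := p.toFactor_add
  map_mul' := p.toFactor_mul

/-- For `p ≤ q`, the connecting map `E / ker q → E / ker p`, `x + ker q ↦ x + ker p`. -/
noncomputable def factorMap {p q : AlgSeminorm E} (h : p.toSeminorm ≤ q.toSeminorm) :
    q.Factor → p.Factor :=
  Submodule.factor (nullSpace_mono h)

theorem factorMap_toFactor {p q : AlgSeminorm E} (h : p.toSeminorm ≤ q.toSeminorm) (x : E) :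
    factorMap h (q.toFactor x) = p.toFactor x := rfl

/-- The connecting map `E / ker q → E / ker p` as a homomorphism of algebras. -/
noncomputable def connectingHom {p q : AlgSeminorm E} (h : p.toSeminorm ≤ q.toSeminorm) :
    q.Factor →ₙₐ[ℂ] p.Factor where
  toFun := factorMap h
  map_smul' c a := by
    obtain ⟨x, rfl⟩ := q.toFactor_surjective a
    rfl
  map_zero' := rfl
  map_add' a b := by
    obtain ⟨x, rfl⟩ := q.toFactor_surjective a
    obtain ⟨y, rfl⟩ := q.toFactor_surjective b
    rfl
  map_mul' a b := by
    obtain ⟨x, rfl⟩ := q.toFactor_surjective a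
    obtain ⟨y, rfl⟩ := q.toFactor_surjective b
    rfl

end Basic

end AlgSeminorm

/-- `(E, (p α))` is a uniform topological algebra: `E` is a Hausdorff topological vector space
with separately continuous multiplication, and its topology is the one determined by the
directed family `p` of uniform seminorms. -/
structure IsUniformTopologicalAlgebra {E Λ : Type*} [NonUnitalRing E] [Module ℂ E]
    [TopologicalSpace E] (p : Λ → AlgSeminorm E) : Prop where
  isTopologicalAddGroup : IsTopologicalAddGroup E
  continuousSMul : ContinuousSMul ℂ E
  t2Space : T2Space E
  separatelyContinuousMul : SeparatelyContinuousMul E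
  withSeminorms : WithSeminorms (fun α => (p α).toSeminorm)
  directed : Directed (· ≤ ·) (fun α => (p α).toSeminorm)
  isUniform : ∀ α, (p α).IsUniform

/-! Both inclusions are one fact: a multiplier preserves the kernel of a homomorphism whose target
has no nonzero element of square zero. The multiplier identity at the pair `x`, `T x` turns the
square of `T x` into a product with left factor `x`, so that square lies in the kernel whenever `x`
does; the condition on the target then puts `T x` itself there. The square property of the seminorm
supplies this condition for `E / ker p`. Both proofs are carried by `IsMultiplier.map_eq_zero` and
`AlgSeminorm.IsUniform.eq_zero_of_mul_self_eq_zero`. -/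

/-- A multiplier preserves the kernel of any multiplicative map into an algebra without nonzero
elements of square zero: if `f x = 0`, then `f (T x) * f (T x) = f (x * T (T x)) = 0`. -/
theorem IsMultiplier.map_eq_zero {A B : Type*} [Mul A] [MulZeroClass B] {T : A → A}
    (hT : IsMultiplier T) (f : A → B) (hf : ∀ x y, f (x * y) = f x * f y)
    (hB : ∀ b : B, b * b = 0 → b = 0) {x : A} (hx : f x = 0) : f (T x) = 0 :=
  hB _ (by rw [← hf, hT x (T x), hf, hx, zero_mul])

/-- The factor algebra of a uniform seminorm has no nonzero elements of square zero. -/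
theorem AlgSeminorm.IsUniform.eq_zero_of_mul_self_eq_zero {E : Type*} [NonUnitalRing E]
    [Module ℂ E] {p : AlgSeminorm E} (hp : p.IsUniform) (a : p.Factor) (ha : a * a = 0) :
    a = 0 := by
  obtain ⟨x, rfl⟩ := p.toFactor_surjective a
  -- The square property enters here: `ha` becomes the vanishing of the real number `p x ^ 2`.
  rw [← AlgSeminorm.toFactor_mul, AlgSeminorm.toFactor_eq_zero, hp x] at ha
  exact AlgSeminorm.toFactor_eq_zero.2 (pow_eq_zero_iff two_ne_zero |>.1 ha)

theorem proposition2p8 {E Λ : Type*} [NonUnitalRing E] [Module ℂ E]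
    [IsScalarTower ℂ E E] [SMulCommClass ℂ E E] [TopologicalSpace E]
    (p : Λ → AlgSeminorm E) (hp : IsUniformTopologicalAlgebra p) :
    (∀ T ∈ multipliers E, ∀ α : Λ,
      T '' (TwoSidedIdeal.ker (p α).quotientHom : Set E) ⊆
        (TwoSidedIdeal.ker (p α).quotientHom : Set E)) ∧
    (∀ (α β : Λ) (h : (p α).toSeminorm ≤ (p β).toSeminorm),
      ∀ U ∈ multipliers (p β).Factor,
        U '' (TwoSidedIdeal.ker (AlgSeminorm.connectingHom h) : Set (p β).Factor) ⊆
          (TwoSidedIdeal.ker (AlgSeminorm.connectingHom h) : Set (p β).Factor)) := by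
  refine ⟨?_, ?_⟩
  · rintro T hT α _ ⟨x, hx, rfl⟩
    rw [SetLike.mem_coe, TwoSidedIdeal.mem_ker] at hx ⊢
    exact IsMultiplier.map_eq_zero hT (p α).quotientHom (map_mul _)
      (hp.isUniform α).eq_zero_of_mul_self_eq_zero hx
  · rintro α β h U hU _ ⟨x, hx, rfl⟩
    rw [SetLike.mem_coe, TwoSidedIdeal.mem_ker] at hx ⊢
    -- Although `U` acts on the factor algebra of `p β`, squares are tested in the target of the
    -- connecting map, so it is the uniformity of `p α` that is needed.
    exact IsMultiplier.map_eq_zero hU (AlgSeminorm.connectingHom h) (map_mul _)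
      (hp.isUniform α).eq_zero_of_mul_self_eq_zero hx
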